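/- Proposition 1. There exist a Borel vector field $B=(B^1,B^2):\mathbb{R}^2\to\mathbb{R}^2$, an integer $m$ and functions $\Omega^i_j:\mathbb{R}^2\to\mathbb{R}$ ($i=1,2$, $j=1,\dots,m$), homogeneous of degree zero, with $\Omega^i_j|_{S^1}\in L^\infty\cap BV(S^1)$ and $\int_{S^1}\Omega^i_j=0$, such that: (a) $\frac{|B(x)|}{|x|+1}\in L^1(\mathbb{R}^2)+L^\infty(\mathbb{R}^2)$ and $\operatorname{div}B=0$ in the sense of distributions on $\mathbb{R}^2$; (b) for every $R>1$ there are bounded signed Radon measures $\mu^l_{jR}$ on $\mathbb{R}^2$ ($l=1,2$, $j=1,\dots,m$) such that for all $i,l\in\{1,2\}$ $$\partial_l B^i=\sum_{j=1}^m\Big(\frac{\Omega^i_j(\cdot)}{|\cdot|^2}\Big)\star\mu^l_{jR}\quad\text{in }\mathcal{D}'(B_R),$$ where $B_R$ is the open ball of radius $R$ centred at the origin and the convolution is the limit in the sense of distributions, as $\varepsilon\downarrow0$, of $\big(\mathbf 1_{|\cdot|>\varepsilon}\,\Omega^i_j/|\cdot|^2\big)\star\mu^l_{jR}$; (c) for every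 $T>0$ there exist two regular Lagrangian flows $X_1,X_2$ of $B$ on $[0,T]$ starting at time $0$ that are different, i.e. for some $t\in[0,T]$ the maps $X_1(t,\cdot)$ and $X_2(t,\cdot)$ do not coincide almost everywhere. Here a regular Lagrangian flow of $B$ on $[0,T]$ starting at time $0$ is a measurable map $X:[0,T]\times\mathbb{R}^2\to\mathbb{R}^2$ such that: $t\mapsto X(t,\cdot)$ is continuous on $[0,T]$ for local convergence in measure; for every $r>0$, $\sup_{t\in[0,T]}\int_{B_r}\log(1+|X(t,x)|)\,dx<\infty$; $\partial_t(h(X))=\nabla h(X)\cdot B(X)$ in $\mathcal{D}'((0,T)\times\mathbb{R}^2)$ for every $h\in C^1(\mathbb{R}^2)$ for which there is a constant $C$ with $|h(z)|\le C(1+\log(1+|z|))$ and $|\nabla h(z)|\le C/(1+|z|)$ for all $z$; $X(0,x)=x$ for a.e. $x$; and there is a constant $L$ with $X(t,\cdot)_\#\mathcal{L}^2\le L\,\mathcal{L}^2$ for all $t\in[0,T]$. -/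

import Mathlib

open MeasureTheory Set Filter Topology
open scoped ENNReal NNReal ContDiff

noncomputable section

/-- `ℝ^d` with its Euclidean norm and Lebesgue measure `volume`. -/
abbrev Space (d : ℕ) : Type := EuclideanSpace ℝ (Fin d)

/-! ### Test functions, divergence, growth -/

/-- `φ ∈ C_c^∞(U)`: smooth, with compact support contained in `U`. -/
structure IsTestFunction {E : Type*} [NormedAddCommGroup E] [NormedSpace ℝ E]
    (U : Set E) (φ : E → ℝ) : Prop where
  smooth : ContDiff ℝ ∞ φ
  compact : HasCompactSupport φ
  support_subset : tsupport φ ⊆ U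

/-- The partial derivative `∂_l φ (x)`. -/
def partialDeriv {d : ℕ} (l : Fin d) (φ : Space d → ℝ) (x : Space d) : ℝ :=
  fderiv ℝ φ x (EuclideanSpace.single l (1 : ℝ))

/-- `div B = 0` in the sense of distributions on `ℝ^d`. -/
def IsDivergenceFree {d : ℕ} (B : Space d → Space d) : Prop :=
  ∀ φ : Space d → ℝ, IsTestFunction univ φ →
    ∫ x, ∑ i, B x i * partialDeriv i φ x = 0

/-- `f ∈ L¹(ℝ^d) + L^∞(ℝ^d)`. -/
def MemL1AddLinfty {d : ℕ} (f : Space d → ℝ) : Prop :=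
  ∃ g h : Space d → ℝ, MemLp g 1 volume ∧ MemLp h ⊤ volume ∧ ∀ᵐ x, f x = g x + h x

/-- The growth condition for a time-dependent field on `(0,T) × ℝ^d`:
`B(t,x) / (1 + |x|) = B₁(t,x) + B₂(t,x)` with
`B₁ ∈ L¹((0,T); L¹(ℝ^d))` and `B₂ ∈ L¹((0,T); L^∞(ℝ^d))`. -/
def GrowthCondition {d : ℕ} (T : ℝ) (B : ℝ → Space d → Space d) : Prop :=
  ∃ B₁ B₂ : ℝ → Space d → Space d,
    AEStronglyMeasurable (fun p : ℝ × Space d => B₁ p.1 p.2)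
      (volume.restrict (Ioo 0 T ×ˢ univ)) ∧
    AEStronglyMeasurable (fun p : ℝ × Space d => B₂ p.1 p.2)
      (volume.restrict (Ioo 0 T ×ˢ univ)) ∧
    (∀ᵐ p : ℝ × Space d ∂(volume.restrict (Ioo 0 T ×ˢ univ)),
      (1 + ‖p.2‖)⁻¹ • B p.1 p.2 = B₁ p.1 p.2 + B₂ p.1 p.2) ∧
    ∫⁻ t in Ioo 0 T, eLpNorm (B₁ t) 1 volume < ⊤ ∧
    ∫⁻ t in Ioo 0 T, eLpNorm (B₂ t) ⊤ volume < ⊤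

/-! ### Regular Lagrangian flows -/

/-- The functions `h ∈ C¹(ℝ^d, ℝ)` with `|h(z)| ≤ C (1 + log (1 + |z|))` and
`|∇h(z)| ≤ C / (1 + |z|)` for some constant `C`. -/
structure IsLogRenormalizer {d : ℕ} (h : Space d → ℝ) : Prop where
  contDiff : ContDiff ℝ 1 h
  bound : ∃ C : ℝ, ∀ z, |h z| ≤ C * (1 + Real.log (1 + ‖z‖)) ∧
    ‖fderiv ℝ h z‖ ≤ C / (1 + ‖z‖)

/-- `X : [t₀,T] × ℝ^d → ℝ^d` is a regular Lagrangian flow, in the renormalized sense, relative to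
the field `B` on `(0,T) × ℝ^d` and starting at time `t₀`. Values of `X` at times outside `[t₀,T]`
are irrelevant. -/
structure IsRegularLagrangianFlow {d : ℕ} (B : ℝ → Space d → Space d) (t₀ T : ℝ)
    (X : ℝ → Space d → Space d) : Prop where
  growth : GrowthCondition T B
  measurable_slice : ∀ t ∈ Icc t₀ T, AEMeasurable (X t) volume
  measurable_joint : AEMeasurable (fun p : ℝ × Space d => X p.1 p.2)
    (volume.restrict (Icc t₀ T ×ˢ univ))
  /-- `X ∈ C([t₀,T]; L⁰_loc(ℝ^d))`: continuity in time for local convergence in measure. -/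
  continuous : ∀ t ∈ Icc t₀ T, ∀ r : ℝ, 0 < r →
    TendstoInMeasure (volume.restrict (Metric.ball 0 r)) X (𝓝[Icc t₀ T] t) (X t)
  /-- `X` is a bounded map from `[t₀,T]` to `log L_loc(ℝ^d)`. -/
  log_bounded : ∀ r : ℝ, 0 < r → ∃ C : ℝ≥0, ∀ t ∈ Icc t₀ T,
    ∫⁻ x in Metric.ball (0 : Space d) r, ENNReal.ofReal (Real.log (1 + ‖X t x‖)) ≤ C
  /-- `∂_t (h(X)) = ∇h(X) · B(t,X)` in the sense of distributions on `(t₀,T) × ℝ^d`. -/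
  equation : ∀ h : Space d → ℝ, IsLogRenormalizer h →
    ∀ ψ : ℝ × Space d → ℝ, IsTestFunction (Ioo t₀ T ×ˢ univ) ψ →
      - ∫ p in Ioo t₀ T ×ˢ (univ : Set (Space d)), h (X p.1 p.2) * fderiv ℝ ψ p (1, 0) =
        ∫ p in Ioo t₀ T ×ˢ (univ : Set (Space d)),
          fderiv ℝ h (X p.1 p.2) (B p.1 (X p.1 p.2)) * ψ p
  initial : ∀ᵐ x, X t₀ x = x
  /-- Bounded compression, uniformly in time: `X(t,·)_# 𝓛^d ≤ L 𝓛^d`. -/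
  compression : ∃ L : ℝ≥0, ∀ t ∈ Icc t₀ T,
    Measure.map (X t) volume ≤ L • (volume : Measure (Space d))

/-! ### Rough homogeneous kernels in the plane -/

/-- The point `(cos θ, sin θ)` of the unit circle. -/
def circlePoint (θ : ℝ) : Space 2 := !₂[Real.cos θ, Real.sin θ]

/-- `f`, read as a function of the angle on `S¹ = ℝ / 2πℤ`, has bounded variation: it is
integrable and its distributional derivative is a bounded measure, i.e. `|∫ f φ'| ≤ C` for
all smooth `φ` on the circle with `|φ| ≤ 1`. -/
def IsBVCircle (f : ℝ → ℝ) : Prop :=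
  IntervalIntegrable f volume 0 (2 * Real.pi) ∧
  ∃ C : ℝ, ∀ φ : ℝ → ℝ, ContDiff ℝ ∞ φ → Function.Periodic φ (2 * Real.pi) →
    (∀ θ, |φ θ| ≤ 1) → |∫ θ in (0 : ℝ)..(2 * Real.pi), f θ * deriv φ θ| ≤ C

/-- `Ω` is homogeneous of degree zero on the plane, its restriction to `S¹` belongs to
`L^∞ ∩ BV`, and `∫_{S¹} Ω = 0`. -/
structure IsRoughProfile (Ω : Space 2 → ℝ) : Prop where
  measurable : Measurable Ω
  homogeneous : ∀ t : ℝ, 0 < t → ∀ x, Ω (t • x) = Ω x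
  bounded : MemLp (fun θ => Ω (circlePoint θ)) ⊤ (volume.restrict (Ioc 0 (2 * Real.pi)))
  bv : IsBVCircle (fun θ => Ω (circlePoint θ))
  mean_zero : ∫ θ in (0 : ℝ)..(2 * Real.pi), Ω (circlePoint θ) = 0

/-- The truncated kernel `1_{|z| > ε} Ω(z) / |z|²`. -/
def truncKernel (Ω : Space 2 → ℝ) (ε : ℝ) (z : Space 2) : ℝ :=
  {z : Space 2 | ε < ‖z‖}.indicator (fun z => Ω z / ‖z‖ ^ 2) z

/-- The convolution `(1_{|·| > ε} Ω / |·|²) ⋆ μ` with a bounded (signed) Radon measure `μ`. -/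
def truncConv (Ω : Space 2 → ℝ) (μ : SignedMeasure (Space 2)) (ε : ℝ) (x : Space 2) : ℝ :=
  ∫ᵛ y, truncKernel Ω ε (x - y) ∂•μ

/-- The distribution `(Ω / |·|²) ⋆ μ`, where `Ω / |·|²` is the principal value kernel, takes the
value `a` at the test function `φ`. -/
def HasSingularConvPairing (Ω : Space 2 → ℝ) (μ : SignedMeasure (Space 2)) (φ : Space 2 → ℝ)
    (a : ℝ) : Prop :=
  Tendsto (fun ε : ℝ => ∫ x, truncConv Ω μ ε x * φ x) (𝓝[>] 0) (𝓝 a)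

/-- `∂_l b = ∑_j (Ω_j / |·|²) ⋆ μ_j` in `𝒟'(U)`. -/
def PartialDerivEqSingularConv {m : ℕ} (U : Set (Space 2)) (l : Fin 2) (b : Space 2 → ℝ)
    (Ω : Fin m → Space 2 → ℝ) (μ : Fin m → SignedMeasure (Space 2)) : Prop :=
  ∀ φ : Space 2 → ℝ, IsTestFunction U φ →
    ∃ a : Fin m → ℝ, (∀ j, HasSingularConvPairing (Ω j) (μ j) φ (a j)) ∧
      - ∫ x, b x * partialDeriv l φ x = ∑ j, a j

end

/-! The field is `dipoleField`, in polar coordinates `B = (cos θ / r) e_r`. It is even, radial and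
homogeneous of degree `-1`. Since `r B_r` does not depend on `r`, the divergence vanishes off the
origin.

The singularity is handled by parity. As `B` is even, pairing it with `∂_l φ` sees only the odd part
of `φ`, which is `O(|x|)` at the origin. The pointwise gradient is `O(|x|⁻²)`, so its product with
the odd part is integrable, and integrating along almost every line parallel to an axis, which
misses the origin, leaves no point mass (`integral_dipoleField_mul_partialDeriv`). The gradient is
thus the principal value of an odd kernel homogeneous of degree `-2`, that is, this kernel convolved
with the Dirac mass at `0`; truncations converge because they too see only the odd part
(`tendsto_integral_truncKernel_mul`).

Along a trajectory the direction is constant and `(r²)' = 2 cos θ`, so points with `cos θ < 0` reach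
the origin in finite time. Afterwards they may leave along any direction with the opposite cosine. A
linear isometry `A` that changes the sign of the first coordinate makes this choice and gives the
explicit map `dipoleFlow A`. The substitution `u² = ±(r² + c)` preserves `r dr`, whence bounded
compression (`lintegral_comp_dipoleFlow_le`). The flow equation is the fundamental theorem of
calculus along each trajectory, with one exceptional time (`dipoleFlow_equation`). The choices `A =
-id` and `A` the reflection in the second axis give flows that differ after crossing. -/

/-! ### Integration by parts across the origin -/

/-- A function dominated by `C / ‖x‖` that vanishes outside a ball is integrable on the plane. -/
theorem integrable_of_norm_le_div_norm {E : Type*} [NormedAddCommGroup E] {f : Space 2 → E}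
    {C r : ℝ} (hm : AEStronglyMeasurable f volume) (hC : ∀ x, ‖f x‖ ≤ C / ‖x‖)
    (hr : ∀ x, r ≤ ‖x‖ → f x = 0) : Integrable f := by
  have h := integrableOn_ball_of_norm_le_rpow (μ := (volume : Measure (Space 2))) (f := f)
    (C := C) (α := 1) (r := r) (by simp) (by simp)
    (ae_of_all _ fun x => by simpa [Real.rpow_neg_one, div_eq_mul_inv] using hC x) hm
  refine (integrableOn_iff_integrable_of_support_subset fun x hx => ?_).1 h
  by_contra hx'
  exact hx (hr x (by simpa using hx'))

/-- The coordinates of the plane adapted to lines parallel to the `l`-th axis. -/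
noncomputable def lineCoord (l : Fin 2) : ℝ × (Fin 1 → ℝ) ≃ᵐ Space 2 :=
  (MeasurableEquiv.piFinSuccAbove (fun _ => ℝ) l).symm.trans (MeasurableEquiv.toLp 2 (Fin 2 → ℝ))

theorem measurePreserving_lineCoord (l : Fin 2) : MeasurePreserving (lineCoord l) :=
  ((volume_preserving_piFinSuccAbove (fun _ : Fin 2 => ℝ) l).symm _).trans
    (PiLp.volume_preserving_toLp (Fin 2))

theorem lineCoord_add (l : Fin 2) (t s : ℝ) (y : Fin 1 → ℝ) :
    lineCoord l (t + s, y) = lineCoord l (t, y) + s • EuclideanSpace.single l (1 : ℝ) := by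
  ext i
  fin_cases l <;> fin_cases i <;>
    simp [lineCoord, MeasurableEquiv.piFinSuccAbove_symm_apply, Fin.insertNth,
      Fin.succAboveCases, Fin.insertNthEquiv]

theorem lineCoord_ne_zero (l : Fin 2) (t : ℝ) {y : Fin 1 → ℝ} (hy : y ≠ 0) :
    lineCoord l (t, y) ≠ 0 := by
  intro h
  apply hy
  have h' : lineCoord l (t, y) = lineCoord l (0, 0) + t • EuclideanSpace.single l (1 : ℝ) := by
    have h0 : lineCoord l (0, 0) = 0 := by
      ext i
      fin_cases l <;> fin_cases i <;>
        simp [lineCoord, MeasurableEquiv.piFinSuccAbove_symm_apply, Fin.insertNthEquiv]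
    have h2 : t = 0 := by
      have := congrArg (fun z : Space 2 => z l) h
      simpa [lineCoord, MeasurableEquiv.piFinSuccAbove_symm_apply, Fin.insertNthEquiv] using this
    rw [h, h0, h2]; simp
  rw [← lineCoord_add, zero_add] at h'
  exact (Prod.ext_iff.1 ((lineCoord l).injective h')).2

/-- The integral of a partial derivative of a compactly supported function of the plane that is
differentiable away from the origin vanishes, as soon as this derivative is integrable. -/
theorem integral_partialDeriv_eq_zero {u : Space 2 → ℝ} (l : Fin 2)
    (hd : ∀ x ≠ 0, DifferentiableAt ℝ u x) (hc : HasCompactSupport u)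
    (hi : Integrable (partialDeriv l u)) : ∫ x, partialDeriv l u x = 0 := by
  have hmp := measurePreserving_lineCoord l
  have hi' : Integrable (fun p => partialDeriv l u (lineCoord l p)) :=
    (hmp.integrable_comp_emb (lineCoord l).measurableEmbedding).2 hi
  rw [← hmp.integral_comp (lineCoord l).measurableEmbedding, Measure.volume_eq_prod,
    integral_prod_symm _ hi']
  refine integral_eq_zero_of_ae ?_
  -- Only the line `y = 0` meets the origin; on every other line `u` is differentiable everywhere.
  have hne : ∀ᵐ y : Fin 1 → ℝ, y ≠ 0 := by simp [ae_iff]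
  filter_upwards [hi'.prod_left_ae, hne] with y hy hy0
  have hderiv : ∀ t, HasDerivAt (fun t => u (lineCoord l (t, y)))
      (partialDeriv l u (lineCoord l (t, y))) t := by
    intro t
    have h1 := (hd _ (lineCoord_ne_zero l t hy0)).hasFDerivAt.hasLineDerivAt
      (EuclideanSpace.single l (1 : ℝ))
    have h2 : HasDerivAt (fun s => u (lineCoord l (s, y)))
        (partialDeriv l u (lineCoord l (t, y))) t := by
      -- The base point `0` of the line derivative is written `t - t`, so that a shift of the
      -- variable moves it to `t`.
      have h3 : HasDerivAt (fun s => u (lineCoord l (t, y) + s • EuclideanSpace.single l (1 : ℝ)))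
        (partialDeriv l u (lineCoord l (t, y))) (t - t) := by
        rw [sub_self]; exact h1
      have h4 := h3.comp_sub_const t t
      simpa [← lineCoord_add] using h4
    exact h2
  refine integral_eq_zero_of_hasDerivAt_of_integrable hderiv hy ?_
  have hcont : Continuous fun t => u (lineCoord l (t, y)) :=
    continuous_iff_continuousAt.2 fun t => (hderiv t).continuousAt
  obtain ⟨r, hr⟩ := hc.isCompact.isBounded.subset_closedBall 0
  refine hcont.integrable_of_hasCompactSupport
    (HasCompactSupport.of_support_subset_isCompact (isCompact_Icc (a := -r) (b := r)) ?_)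
  intro t ht
  have h1 : ‖lineCoord l (t, y)‖ ≤ r := by simpa using hr (subset_tsupport _ ht)
  have h2 : (lineCoord l (t, y)) l = t := by
    simp [lineCoord, MeasurableEquiv.piFinSuccAbove_symm_apply, Fin.insertNthEquiv]
  have h3 := PiLp.norm_apply_le (lineCoord l (t, y)) l
  rw [h2] at h3
  exact abs_le.1 (h3.trans h1)

/-! ### The field -/

/-- The radial field `x₁ x / |x|³`, homogeneous of degree `-1`. -/
noncomputable def dipoleField (x : Space 2) : Space 2 := (x 0 / ‖x‖ ^ 3) • x

/-- The profile `|x|² ∂_j B^i` of the gradient of the field. -/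
noncomputable def dipoleProfile (i j : Fin 2) (x : Space 2) : ℝ :=
  ((if j = 0 then 1 else 0) * x i + (if i = j then 1 else 0) * x 0) / ‖x‖
    - 3 * x 0 * x i * x j / ‖x‖ ^ 3

theorem measurable_dipoleField : Measurable dipoleField := by
  unfold dipoleField; fun_prop

theorem measurable_dipoleProfile (i j : Fin 2) : Measurable (dipoleProfile i j) := by
  unfold dipoleProfile; fun_prop

theorem dipoleField_neg (x : Space 2) : dipoleField (-x) = dipoleField x := by
  simp [dipoleField, neg_div]

theorem dipoleProfile_neg (i j : Fin 2) (x : Space 2) :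
    dipoleProfile i j (-x) = -dipoleProfile i j x := by
  simp only [dipoleProfile, PiLp.neg_apply, norm_neg]; ring

theorem dipoleProfile_smul (i j : Fin 2) {t : ℝ} (ht : 0 < t) (x : Space 2) :
    dipoleProfile i j (t • x) = dipoleProfile i j x := by
  rcases eq_or_ne x 0 with rfl | hx
  · simp
  have hx' : ‖x‖ ≠ 0 := norm_ne_zero_iff.2 hx
  simp only [dipoleProfile, PiLp.smul_apply, norm_smul, smul_eq_mul, Real.norm_eq_abs, abs_of_pos ht]
  field_simp

/-- This is the pointwise vanishing of the divergence, multiplied by `|x|²`. -/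
theorem sum_dipoleProfile (x : Space 2) : ∑ i, dipoleProfile i i x = 0 := by
  rcases eq_or_ne x 0 with rfl | hx
  · simp [dipoleProfile]
  have hx' : ‖x‖ ≠ 0 := norm_ne_zero_iff.2 hx
  have h2 : ‖x‖ ^ 2 = x 0 ^ 2 + x 1 ^ 2 := by
    rw [EuclideanSpace.norm_sq_eq, Fin.sum_univ_two]; simp
  simp only [dipoleProfile, Fin.sum_univ_two]
  field_simp
  simp
  linear_combination (3 * x 0) * h2

theorem norm_dipoleField_le (x : Space 2) : ‖dipoleField x‖ ≤ 1 / ‖x‖ := by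
  rcases eq_or_ne x 0 with rfl | hx
  · simp [dipoleField]
  have hx' : 0 < ‖x‖ := norm_pos_iff.2 hx
  have h := PiLp.norm_apply_le x 0
  rw [dipoleField, norm_smul, norm_div, norm_pow, norm_norm, div_mul_eq_mul_div,
    div_le_div_iff₀ (by positivity) hx']
  calc ‖x 0‖ * ‖x‖ * ‖x‖ ≤ ‖x‖ * ‖x‖ * ‖x‖ := by gcongr
    _ = 1 * ‖x‖ ^ 3 := by ring

theorem abs_dipoleField_apply_le (i : Fin 2) (x : Space 2) : |dipoleField x i| ≤ 1 / ‖x‖ :=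
  (PiLp.norm_apply_le (dipoleField x) i).trans (norm_dipoleField_le x)

/-- Each coordinate of `x / |x|` is at most `1` in absolute value, so the three terms contribute `1
+ 1 + 3`. -/
theorem abs_dipoleProfile_le (i j : Fin 2) (x : Space 2) : |dipoleProfile i j x| ≤ 5 := by
  rcases eq_or_ne x 0 with rfl | hx
  · simp [dipoleProfile]
  have hx' : 0 < ‖x‖ := norm_pos_iff.2 hx
  have h : ∀ k, |x k / ‖x‖| ≤ 1 := fun k => by
    rw [abs_div, abs_norm, div_le_one hx']; exact PiLp.norm_apply_le x k
  have hite : ∀ p : Prop, ∀ [Decidable p], |(if p then (1 : ℝ) else 0)| ≤ 1 := fun p _ => by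
    split_ifs <;> simp
  have e : dipoleProfile i j x = (if j = 0 then 1 else 0) * (x i / ‖x‖)
      + (if i = j then 1 else 0) * (x 0 / ‖x‖)
      - 3 * ((x 0 / ‖x‖) * (x i / ‖x‖) * (x j / ‖x‖)) := by
    simp only [dipoleProfile]; field_simp
  rw [e]
  have a1 : |(if j = 0 then (1 : ℝ) else 0) * (x i / ‖x‖)| ≤ 1 := by
    rw [abs_mul]; exact mul_le_one₀ (hite _) (abs_nonneg _) (h i)
  have a2 : |(if i = j then (1 : ℝ) else 0) * (x 0 / ‖x‖)| ≤ 1 := by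
    rw [abs_mul]; exact mul_le_one₀ (hite _) (abs_nonneg _) (h 0)
  have a3 : |(x 0 / ‖x‖) * (x i / ‖x‖) * (x j / ‖x‖)| ≤ 1 := by
    rw [abs_mul, abs_mul]
    exact mul_le_one₀ (mul_le_one₀ (h 0) (abs_nonneg _) (h i)) (abs_nonneg _) (h j)
  rw [abs_le] at *
  constructor <;> linarith [a1.1, a1.2, a2.1, a2.2, a3.1, a3.2]

theorem hasFDerivAt_norm_of_ne_zero {E : Type*} [NormedAddCommGroup E] [InnerProductSpace ℝ E]
    {x : E} (hx : x ≠ 0) : HasFDerivAt (fun x : E => ‖x‖) (‖x‖⁻¹ • innerSL ℝ x) x := by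
  have h := (hasStrictFDerivAt_norm_sq x).hasFDerivAt.sqrt (by simpa using hx)
  simp only [Real.sqrt_sq (norm_nonneg _)] at h
  convert h using 1
  ext v
  simp
  field_simp

theorem hasFDerivAt_coord (i : Fin 2) (x : Space 2) :
    HasFDerivAt (fun x : Space 2 => x i) (EuclideanSpace.proj i : Space 2 →L[ℝ] ℝ) x :=
  (EuclideanSpace.proj i : Space 2 →L[ℝ] ℝ).hasFDerivAt

theorem differentiableAt_dipoleField (i : Fin 2) {x : Space 2} (hx : x ≠ 0) :
    DifferentiableAt ℝ (fun x => dipoleField x i) x := by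
  have hn := (hasFDerivAt_norm_of_ne_zero hx).differentiableAt
  have h0 := (hasFDerivAt_coord 0 x).differentiableAt
  have hi := (hasFDerivAt_coord i x).differentiableAt
  have hx3 : ‖x‖ ^ 3 ≠ 0 := pow_ne_zero 3 (norm_ne_zero_iff.2 hx)
  have h3 : DifferentiableAt ℝ (fun x : Space 2 => (‖x‖ ^ 3)⁻¹) x := (hn.fun_pow 3).fun_inv hx3
  simpa [dipoleField, div_eq_mul_inv] using (h0.fun_mul h3).fun_mul hi

theorem partialDeriv_dipoleField (i l : Fin 2) {x : Space 2} (hx : x ≠ 0) :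
    partialDeriv l (fun x => dipoleField x i) x = dipoleProfile i l x / ‖x‖ ^ 2 := by
  have hx' : ‖x‖ ≠ 0 := norm_ne_zero_iff.2 hx
  set e : Space 2 := EuclideanSpace.single l (1 : ℝ) with he
  have hn : HasDerivAt (fun s : ℝ => ‖x + s • e‖) (x l / ‖x‖) 0 := by
    have h := (hasFDerivAt_norm_of_ne_zero hx).hasLineDerivAt e
    simpa [HasLineDerivAt, he, EuclideanSpace.inner_single_right, div_eq_inv_mul] using h
  have hc : ∀ k, HasDerivAt (fun s : ℝ => (x + s • e) k) (e k) 0 := fun k => by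
    simpa using ((hasDerivAt_id (0 : ℝ)).mul_const (e k)).const_add (x k)
  have hd := ((hc 0).div (hn.pow 3) (by simpa using hx)).mul (hc i)
  have h1 := ((differentiableAt_dipoleField i hx).hasFDerivAt.hasLineDerivAt e)
  have h2 := HasDerivAt.unique h1 hd
  rw [partialDeriv, h2]
  simp only [dipoleProfile, he, PiLp.single_apply, Pi.pow_apply, Pi.div_apply, zero_smul, add_zero]
  field_simp
  fin_cases l <;> fin_cases i <;> simp <;> ring

/-! ### The gradient of the field as a principal value -/

/-- The odd part of a function. -/
noncomputable def oddPart (φ : Space 2 → ℝ) (x : Space 2) : ℝ := (φ x - φ (-x)) / 2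

theorem contDiff_oddPart {φ : Space 2 → ℝ} (hs : ContDiff ℝ ∞ φ) : ContDiff ℝ ∞ (oddPart φ) :=
  (hs.sub (hs.comp contDiff_neg)).div_const 2

theorem hasCompactSupport_oddPart {φ : Space 2 → ℝ} (hc : HasCompactSupport φ) :
    HasCompactSupport (oddPart φ) := by
  have h := hc.sub (hc.comp_homeomorph (Homeomorph.neg (Space 2)))
  exact h.comp_left (g := fun r : ℝ => r / 2) (by simp)

/-- The odd part is Lipschitz and vanishes at the origin. This gain of one power of `|x|` makes the
degree `-2` kernel integrable against it. -/
theorem exists_abs_oddPart_le {φ : Space 2 → ℝ} (hs : ContDiff ℝ ∞ φ) (hc : HasCompactSupport φ) :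
    ∃ C : ℝ, 0 ≤ C ∧ ∀ x, |oddPart φ x| ≤ C * ‖x‖ := by
  obtain ⟨C, hC⟩ := (contDiff_oddPart hs).lipschitzWith_of_hasCompactSupport
    (hasCompactSupport_oddPart hc) (by simp)
  refine ⟨C, C.2, fun x => ?_⟩
  have h0 : oddPart φ 0 = 0 := by simp [oddPart]
  simpa [h0] using hC.norm_sub_le x 0

theorem partialDeriv_oddPart {φ : Space 2 → ℝ} (hs : ContDiff ℝ ∞ φ) (l : Fin 2) (x : Space 2) :
    partialDeriv l (oddPart φ) x = (partialDeriv l φ x + partialDeriv l φ (-x)) / 2 := by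
  have hd : Differentiable ℝ φ := hs.differentiable (by simp)
  have h1 := (hd x).hasFDerivAt.hasLineDerivAt (EuclideanSpace.single l (1 : ℝ))
  have h2 := (hd (-x)).hasFDerivAt.hasLineDerivAt (-EuclideanSpace.single l (1 : ℝ))
  have h3 := ((contDiff_oddPart hs).differentiable (by simp) x).hasFDerivAt.hasLineDerivAt
    (EuclideanSpace.single l (1 : ℝ))
  have h4 : HasLineDerivAt ℝ (oddPart φ) ((partialDeriv l φ x + partialDeriv l φ (-x)) / 2) x
      (EuclideanSpace.single l (1 : ℝ)) := by
    have h5 := (HasDerivAt.fun_sub h1 h2).div_const 2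
    rw [map_neg, sub_neg_eq_add] at h5
    refine h5.congr_of_eventuallyEq (Eventually.of_forall fun t => ?_)
    simp only [oddPart, smul_neg, neg_add]
  exact h3.unique h4

theorem exists_support_bound {φ : Space 2 → ℝ} (hc : HasCompactSupport φ) :
    ∃ r : ℝ, ∀ x, r ≤ ‖x‖ → φ x = 0 := by
  obtain ⟨r, hr⟩ := hc.isCompact.isBounded.subset_ball 0
  refine ⟨r, fun x hx => image_eq_zero_of_notMem_tsupport fun h => ?_⟩
  have := hr h
  simp only [Metric.mem_ball, dist_zero_right] at this
  exact this.not_ge hx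

/-- The product of a kernel bounded by `C / ‖x‖` and a continuous compactly supported function
is integrable. -/
theorem integrable_mul_of_abs_le_div {k φ : Space 2 → ℝ} {C : ℝ} (hk : Measurable k)
    (hC : ∀ x, |k x| ≤ C / ‖x‖) (hφ : Continuous φ) (hc : HasCompactSupport φ) :
    Integrable fun x => k x * φ x := by
  obtain ⟨M, hM⟩ := hφ.bounded_above_of_compact_support hc
  obtain ⟨r, hr⟩ := exists_support_bound hc
  refine integrable_of_norm_le_div_norm (C := C * M) (r := r)
    (hk.mul hφ.measurable).aestronglyMeasurable (fun x => ?_) (fun x hx => by simp [hr x hx])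
  rw [norm_mul, mul_div_right_comm]
  exact mul_le_mul (hC x) (hM x) (norm_nonneg _) ((abs_nonneg _).trans (hC x))

theorem continuous_partialDeriv {φ : Space 2 → ℝ} (hs : ContDiff ℝ ∞ φ) (l : Fin 2) :
    Continuous (partialDeriv l φ) :=
  (hs.continuous_fderiv (by simp)).clm_apply continuous_const

theorem hasCompactSupport_partialDeriv {φ : Space 2 → ℝ} (hc : HasCompactSupport φ) (l : Fin 2) :
    HasCompactSupport (partialDeriv l φ) :=
  (hc.fderiv (𝕜 := ℝ)).comp_left
    (g := fun L : Space 2 →L[ℝ] ℝ => L (EuclideanSpace.single l (1 : ℝ))) (by simp)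

theorem integrable_dipoleField_mul {φ : Space 2 → ℝ} (i : Fin 2) (hφ : Continuous φ)
    (hc : HasCompactSupport φ) : Integrable fun x => dipoleField x i * φ x :=
  integrable_mul_of_abs_le_div (k := fun x => dipoleField x i)
    ((PiLp.continuous_apply 2 _ i).measurable.comp measurable_dipoleField)
    (abs_dipoleField_apply_le i) hφ hc

theorem abs_dipoleKernel_mul_oddPart_le {φ : Space 2 → ℝ} {C : ℝ}
    (hC : ∀ x, |oddPart φ x| ≤ C * ‖x‖) (i l : Fin 2) (x : Space 2) :
    |dipoleProfile i l x / ‖x‖ ^ 2 * oddPart φ x| ≤ 5 * C / ‖x‖ := by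
  rcases eq_or_ne x 0 with rfl | hx
  · simp
  have hx' : 0 < ‖x‖ := norm_pos_iff.2 hx
  rw [abs_mul, abs_div, abs_of_pos (by positivity : 0 < ‖x‖ ^ 2)]
  calc |dipoleProfile i l x| / ‖x‖ ^ 2 * |oddPart φ x| ≤ 5 / ‖x‖ ^ 2 * (C * ‖x‖) := by
        gcongr
        · exact abs_dipoleProfile_le i l x
        · exact hC x
    _ = 5 * C / ‖x‖ := by field_simp

theorem integrable_dipoleKernel_mul_oddPart {φ : Space 2 → ℝ} (hs : ContDiff ℝ ∞ φ)
    (hc : HasCompactSupport φ) (i l : Fin 2) :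
    Integrable fun x => dipoleProfile i l x / ‖x‖ ^ 2 * oddPart φ x := by
  obtain ⟨C, -, hC⟩ := exists_abs_oddPart_le hs hc
  obtain ⟨r, hr⟩ := exists_support_bound (hasCompactSupport_oddPart hc)
  refine integrable_of_norm_le_div_norm (C := 5 * C) (r := r) ?_
    (abs_dipoleKernel_mul_oddPart_le hC i l) (fun x hx => by simp [hr x hx])
  have := measurable_dipoleProfile i l
  have := (contDiff_oddPart hs).continuous.measurable
  exact Measurable.aestronglyMeasurable (by fun_prop)

/-- Evenness of the field replaces `∂_l φ` by its even part, which is `∂_l` of the odd part of `φ`.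
The product of the field with the odd part then has an integrable derivative, and integration by
parts yields no term at the origin. -/
theorem integral_dipoleField_mul_partialDeriv {φ : Space 2 → ℝ} (hs : ContDiff ℝ ∞ φ)
    (hc : HasCompactSupport φ) (i l : Fin 2) :
    ∫ x, dipoleField x i * partialDeriv l φ x =
      -∫ x, dipoleProfile i l x / ‖x‖ ^ 2 * oddPart φ x := by
  have hso := contDiff_oddPart hs
  have hco := hasCompactSupport_oddPart hc
  have hI := integrable_dipoleField_mul i (continuous_partialDeriv hs l)
    (hasCompactSupport_partialDeriv hc l)
  have hIo := integrable_dipoleField_mul i (continuous_partialDeriv hso l)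
    (hasCompactSupport_partialDeriv hco l)
  have hK := integrable_dipoleKernel_mul_oddPart hs hc i l
  have hodd : ∫ x, dipoleField x i * partialDeriv l φ x =
      ∫ x, dipoleField x i * partialDeriv l (oddPart φ) x := by
    have hneg : ∫ x, dipoleField x i * partialDeriv l φ (-x) =
        ∫ x, dipoleField x i * partialDeriv l φ x := by
      rw [← integral_neg_eq_self (fun x => dipoleField x i * partialDeriv l φ x)]
      simp only [dipoleField_neg]
    have hIn : Integrable fun x => dipoleField x i * partialDeriv l φ (-x) := by
      simpa only [dipoleField_neg] using hI.comp_neg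
    have : ∀ x, dipoleField x i * partialDeriv l (oddPart φ) x =
        (dipoleField x i * partialDeriv l φ x + dipoleField x i * partialDeriv l φ (-x)) / 2 :=
      fun x => by rw [partialDeriv_oddPart hs]; ring
    simp_rw [this]
    rw [integral_div, integral_add hI hIn, hneg]
    ring
  have hd : ∀ x ≠ 0, HasFDerivAt (fun x => dipoleField x i * oddPart φ x)
      (dipoleField x i • fderiv ℝ (oddPart φ) x +
        oddPart φ x • fderiv ℝ (fun x => dipoleField x i) x) x := fun x hx =>
    (differentiableAt_dipoleField i hx).hasFDerivAt.fun_mul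
      (hso.differentiable (by simp) x).hasFDerivAt
  have hae : (fun x => dipoleField x i * partialDeriv l (oddPart φ) x +
      dipoleProfile i l x / ‖x‖ ^ 2 * oddPart φ x) =ᵐ[volume]
      partialDeriv l (fun x => dipoleField x i * oddPart φ x) := by
    have : ∀ᵐ x : Space 2, x ≠ 0 := by simp [ae_iff]
    filter_upwards [this] with x hx
    rw [← partialDeriv_dipoleField i l hx]
    simp only [partialDeriv, (hd x hx).fderiv, add_apply, smul_apply, smul_eq_mul]
    ring
  have hz := integral_partialDeriv_eq_zero l (fun x hx => (hd x hx).differentiableAt)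
    (hco.mul_left) ((hIo.add hK).congr hae)
  rw [← integral_congr_ae hae, integral_add hIo hK] at hz
  rw [hodd]
  linarith

/-- After integration by parts the integrand carries the trace of the gradient, which is zero. -/
theorem isDivergenceFree_dipoleField : IsDivergenceFree dipoleField := by
  intro φ hφ
  rw [integral_finsetSum _ fun i _ => integrable_dipoleField_mul i
    (continuous_partialDeriv hφ.smooth i) (hasCompactSupport_partialDeriv hφ.compact i)]
  simp_rw [integral_dipoleField_mul_partialDeriv hφ.smooth hφ.compact]
  rw [Finset.sum_neg_distrib, ← integral_finsetSum _ fun i _ =>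
    integrable_dipoleKernel_mul_oddPart hφ.smooth hφ.compact i i]
  simp_rw [← Finset.sum_mul, ← Finset.sum_div, sum_dipoleProfile]
  simp

theorem truncKernel_neg (i l : Fin 2) (ε : ℝ) (x : Space 2) :
    truncKernel (dipoleProfile i l) ε (-x) = -truncKernel (dipoleProfile i l) ε x := by
  simp only [truncKernel, indicator_apply, mem_ofPred_eq, norm_neg, dipoleProfile_neg]
  split_ifs <;> ring

theorem measurable_truncKernel (i l : Fin 2) (ε : ℝ) :
    Measurable (truncKernel (dipoleProfile i l) ε) := by
  have := measurable_dipoleProfile i l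
  exact Measurable.indicator (by fun_prop) (measurableSet_lt measurable_const measurable_norm)

theorem integrable_truncKernel_mul {φ : Space 2 → ℝ} (i l : Fin 2) {ε : ℝ} (hε : 0 < ε)
    (hφ : Continuous φ) (hc : HasCompactSupport φ) :
    Integrable fun x => truncKernel (dipoleProfile i l) ε x * φ x := by
  refine integrable_mul_of_abs_le_div (C := 5 / ε) (measurable_truncKernel i l ε)
    (fun x => ?_) hφ hc
  simp only [truncKernel, indicator_apply, mem_ofPred_eq]
  split_ifs with h
  · have hx : 0 < ‖x‖ := hε.trans h
    rw [abs_div, abs_of_pos (by positivity : 0 < ‖x‖ ^ 2), div_div, sq]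
    gcongr
    exact abs_dipoleProfile_le i l x
  · rw [abs_zero]; positivity

theorem integral_truncKernel_mul {φ : Space 2 → ℝ} (hs : ContDiff ℝ ∞ φ)
    (hc : HasCompactSupport φ) (i l : Fin 2) {ε : ℝ} (hε : 0 < ε) :
    ∫ x, truncKernel (dipoleProfile i l) ε x * φ x =
      ∫ x, truncKernel (dipoleProfile i l) ε x * oddPart φ x := by
  have hI := integrable_truncKernel_mul i l hε hs.continuous hc
  have hneg : ∫ x, truncKernel (dipoleProfile i l) ε x * φ (-x) =
      -∫ x, truncKernel (dipoleProfile i l) ε x * φ x := by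
    rw [← integral_neg_eq_self (fun x => truncKernel (dipoleProfile i l) ε x * φ x),
      ← integral_neg]
    simp only [truncKernel_neg, neg_mul, neg_neg]
  have hIn : Integrable fun x => truncKernel (dipoleProfile i l) ε x * φ (-x) := by
    simpa only [truncKernel_neg, neg_mul, neg_neg, Pi.neg_def] using hI.comp_neg.neg
  have : ∀ x, truncKernel (dipoleProfile i l) ε x * oddPart φ x =
      (truncKernel (dipoleProfile i l) ε x * φ x -
        truncKernel (dipoleProfile i l) ε x * φ (-x)) / 2 := fun x => by rw [oddPart]; ring
  simp_rw [this]
  rw [integral_div, integral_sub hI hIn, hneg]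
  ring

/-- The truncated kernels are odd, so `φ` may be replaced by its odd part; the untruncated integrand
is then an integrable majorant and dominated convergence applies. -/
theorem tendsto_integral_truncKernel_mul {φ : Space 2 → ℝ} (hs : ContDiff ℝ ∞ φ)
    (hc : HasCompactSupport φ) (i l : Fin 2) :
    Tendsto (fun ε : ℝ => ∫ x, truncKernel (dipoleProfile i l) ε x * φ x) (𝓝[>] 0)
      (𝓝 (∫ x, dipoleProfile i l x / ‖x‖ ^ 2 * oddPart φ x)) := by
  have hpos : ∀ᶠ ε : ℝ in 𝓝[>] 0, 0 < ε := self_mem_nhdsWithin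
  have key : Tendsto (fun ε : ℝ => ∫ x, truncKernel (dipoleProfile i l) ε x * oddPart φ x)
      (𝓝[>] 0) (𝓝 (∫ x, dipoleProfile i l x / ‖x‖ ^ 2 * oddPart φ x)) := by
    refine tendsto_integral_filter_of_dominated_convergence
      (fun x => |dipoleProfile i l x / ‖x‖ ^ 2 * oddPart φ x|) ?_ ?_
      (integrable_dipoleKernel_mul_oddPart hs hc i l).abs ?_
    · exact Eventually.of_forall fun ε => ((measurable_truncKernel i l ε).mul
        (contDiff_oddPart hs).continuous.measurable).aestronglyMeasurable
    · refine Eventually.of_forall fun ε => Eventually.of_forall fun x => ?_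
      rw [Real.norm_eq_abs, abs_mul, abs_mul]
      refine mul_le_mul_of_nonneg_right ?_ (abs_nonneg _)
      simp only [truncKernel, indicator_apply]
      split_ifs
      · exact le_rfl
      · simp
    · refine Eventually.of_forall fun x => ?_
      rcases eq_or_ne x 0 with rfl | hx
      · simp [oddPart]
      refine tendsto_const_nhds.congr' ?_
      have hlt : ∀ᶠ ε : ℝ in 𝓝[>] 0, ε < ‖x‖ :=
        nhdsWithin_le_nhds (Iio_mem_nhds (norm_pos_iff.2 hx))
      filter_upwards [hlt] with ε hε
      simp [truncKernel, hε]
  refine key.congr' ?_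
  filter_upwards [hpos] with ε hε
  exact (integral_truncKernel_mul hs hc i l hε).symm

theorem truncConv_dirac (Ω : Space 2 → ℝ) (ε : ℝ) (x : Space 2) :
    truncConv Ω (VectorMeasure.dirac 0 1) ε x = truncKernel Ω ε x := by
  rw [truncConv, VectorMeasure.integral_dirac]
  simp

theorem truncConv_zero (Ω : Space 2 → ℝ) (ε : ℝ) (x : Space 2) : truncConv Ω 0 ε x = 0 := by
  rw [truncConv, VectorMeasure.integral_zero_vectorMeasure]

/-- One kernel per direction of differentiation: the Dirac mass sits at the index `j = l` only, so
the sum reduces to the kernel of `∂_l B^i`. The measures serve for every open set, hence for every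
radius. -/
theorem partialDerivEqSingularConv_dipoleField (U : Set (Space 2)) (i l : Fin 2) :
    PartialDerivEqSingularConv U l (fun x => dipoleField x i) (dipoleProfile i)
      (fun j : Fin 2 => if l = j then VectorMeasure.dirac 0 1 else 0) := by
  intro φ hφ
  refine ⟨fun j => if l = j then ∫ x, dipoleProfile i l x / ‖x‖ ^ 2 * oddPart φ x else 0,
    fun j => ?_, ?_⟩
  · by_cases h : l = j
    · subst h
      simp only [HasSingularConvPairing, if_true, truncConv_dirac]
      exact tendsto_integral_truncKernel_mul hφ.smooth hφ.compact i l
    · simp only [HasSingularConvPairing, if_neg h, truncConv_zero]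
      simp
  · rw [integral_dipoleField_mul_partialDeriv hφ.smooth hφ.compact]
    simp

/-! ### The profiles on the circle and the growth of the field -/

theorem norm_circlePoint (θ : ℝ) : ‖circlePoint θ‖ = 1 := by
  rw [circlePoint, EuclideanSpace.norm_eq, Fin.sum_univ_two]
  simp

theorem contDiff_circlePoint_apply (k : Fin 2) : ContDiff ℝ ∞ fun θ => circlePoint θ k := by
  fin_cases k
  · simpa [circlePoint] using Real.contDiff_cos
  · simpa [circlePoint] using Real.contDiff_sin

theorem circlePoint_add_pi (θ : ℝ) : circlePoint (θ + Real.pi) = -circlePoint θ := by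
  ext i
  fin_cases i <;> simp [circlePoint, Real.cos_add_pi, Real.sin_add_pi]

theorem contDiff_dipoleProfile_circlePoint (i j : Fin 2) :
    ContDiff ℝ ∞ fun θ => dipoleProfile i j (circlePoint θ) := by
  simp only [dipoleProfile, norm_circlePoint, div_one, one_pow]
  have h := contDiff_circlePoint_apply
  exact ((contDiff_const.mul (h i)).add (contDiff_const.mul (h 0))).sub
    (((contDiff_const.mul (h 0)).mul (h i)).mul (h j))

/-- On the circle the profile is a smooth function of the angle that changes sign under `θ ↦ θ + π`.
Antiperiodicity gives mean zero, and integration by parts with periodic boundary terms bounds the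
variation by `∫ |f'|`. -/
theorem isRoughProfile_dipoleProfile (i j : Fin 2) : IsRoughProfile (dipoleProfile i j) := by
  set f : ℝ → ℝ := fun θ => dipoleProfile i j (circlePoint θ) with hf
  have hs : ContDiff ℝ ∞ f := contDiff_dipoleProfile_circlePoint i j
  have hanti : ∀ θ, f (θ + Real.pi) = -f θ := fun θ => by
    simp only [hf, circlePoint_add_pi, dipoleProfile_neg]
  have hper : Function.Periodic f (2 * Real.pi) := fun θ => by
    rw [two_mul, ← add_assoc, hanti, hanti, neg_neg]
  refine ⟨measurable_dipoleProfile i j, fun t ht x => dipoleProfile_smul i j ht x, ?_, ?_, ?_⟩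
  · exact memLp_top_of_bound hs.continuous.aestronglyMeasurable 5
      (Eventually.of_forall fun θ => abs_dipoleProfile_le i j _)
  · refine ⟨hs.continuous.intervalIntegrable _ _,
      ∫ θ in (0 : ℝ)..(2 * Real.pi), |deriv f θ|, fun φ hφ hφp hφ1 => ?_⟩
    have hf' : Continuous (deriv f) := hs.continuous_deriv (by simp)
    have hφ' : Continuous (deriv φ) := hφ.continuous_deriv (by simp)
    rw [intervalIntegral.integral_mul_deriv_eq_deriv_mul
      (u := f) (v := φ) (u' := deriv f) (v' := deriv φ)
      (fun x _ => (hs.differentiable (by simp) x).hasDerivAt)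
      (fun x _ => (hφ.differentiable (by simp) x).hasDerivAt)
      (hf'.intervalIntegrable _ _) (hφ'.intervalIntegrable _ _)]
    rw [show f (2 * Real.pi) = f 0 by simpa using hper 0,
      show φ (2 * Real.pi) = φ 0 by simpa using hφp 0, sub_self, zero_sub, abs_neg]
    have hpi : (0 : ℝ) ≤ 2 * Real.pi := by positivity
    refine (intervalIntegral.abs_integral_le_integral_abs hpi).trans
      (intervalIntegral.integral_mono_on hpi ((hf'.mul hφ.continuous).abs.intervalIntegrable _ _)
        (hf'.abs.intervalIntegrable _ _) fun θ _ => ?_)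
    rw [abs_mul]
    exact mul_le_of_le_one_right (abs_nonneg _) (hφ1 θ)
  · have h1 := hper.intervalIntegral_add_eq Real.pi 0
    have h2 := intervalIntegral.integral_comp_add_right (a := 0) (b := 2 * Real.pi) f Real.pi
    simp only [hanti, intervalIntegral.integral_neg] at h2
    rw [zero_add, add_comm (2 * Real.pi), h1, zero_add] at h2
    linarith

/-- The weighted field is cut at the unit circle: inside it is `O(1/|x|)`, integrable in the plane,
and outside it is bounded by `1`. -/
theorem norm_indicator_ball_dipoleField_le (x : Space 2) :
    ‖(Metric.ball 0 1).indicator (fun x : Space 2 => (1 + ‖x‖)⁻¹ • dipoleField x) x‖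
      ≤ 1 / ‖x‖ := by
  refine (norm_indicator_le_norm_self _ _).trans ?_
  rw [norm_smul, norm_inv, Real.norm_of_nonneg (by positivity)]
  calc (1 + ‖x‖)⁻¹ * ‖dipoleField x‖ ≤ 1 * (1 / ‖x‖) := by
        gcongr
        · exact inv_le_one_of_one_le₀ (by linarith [norm_nonneg x])
        · exact norm_dipoleField_le x
    _ = 1 / ‖x‖ := one_mul _

theorem norm_indicator_compl_ball_dipoleField_le (x : Space 2) :
    ‖(Metric.ball 0 1)ᶜ.indicator (fun x : Space 2 => (1 + ‖x‖)⁻¹ • dipoleField x) x‖ ≤ 1 := by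
  by_cases h : x ∈ (Metric.ball (0 : Space 2) 1)ᶜ
  · have hx : 1 ≤ ‖x‖ := by simpa using h
    rw [indicator_of_mem h, norm_smul, norm_inv, Real.norm_of_nonneg (by positivity)]
    exact mul_le_one₀ (inv_le_one_of_one_le₀ (by linarith)) (norm_nonneg _)
      ((norm_dipoleField_le x).trans (by rw [div_le_one (by linarith)]; exact hx))
  · rw [indicator_of_notMem h, norm_zero]; exact zero_le_one

theorem measurable_weighted_dipoleField :
    Measurable fun x : Space 2 => (1 + ‖x‖)⁻¹ • dipoleField x := by
  have := measurable_dipoleField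
  fun_prop

theorem integrable_indicator_ball_dipoleField :
    Integrable ((Metric.ball 0 1).indicator
      fun x : Space 2 => (1 + ‖x‖)⁻¹ • dipoleField x) :=
  integrable_of_norm_le_div_norm (r := 1)
    (measurable_weighted_dipoleField.indicator measurableSet_ball).aestronglyMeasurable
    norm_indicator_ball_dipoleField_le fun x hx => by simp [hx]

theorem memLp_indicator_compl_ball_dipoleField :
    MemLp ((Metric.ball 0 1)ᶜ.indicator
      fun x : Space 2 => (1 + ‖x‖)⁻¹ • dipoleField x) ⊤ :=
  memLp_top_of_bound
    (measurable_weighted_dipoleField.indicator measurableSet_ball.compl).aestronglyMeasurable 1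
    (Eventually.of_forall norm_indicator_compl_ball_dipoleField_le)

theorem memL1AddLinfty_dipoleField :
    MemL1AddLinfty fun x : Space 2 => ‖dipoleField x‖ / (‖x‖ + 1) := by
  refine ⟨_, _, (memLp_one_iff_integrable.2 integrable_indicator_ball_dipoleField).norm,
    memLp_indicator_compl_ball_dipoleField.norm, Eventually.of_forall fun x => ?_⟩
  have h : ‖dipoleField x‖ / (‖x‖ + 1) = ‖(1 + ‖x‖)⁻¹ • dipoleField x‖ := by
    rw [norm_smul, norm_inv, Real.norm_of_nonneg (by positivity), add_comm, div_eq_inv_mul]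
  by_cases hx : x ∈ Metric.ball (0 : Space 2) 1
  · simp only [indicator_of_mem hx, h, indicator_of_notMem (notMem_compl_iff.2 hx), norm_zero,
      add_zero]
  · simp only [indicator_of_notMem hx, h, indicator_of_mem (mem_compl hx), norm_zero, zero_add]

theorem growthCondition_dipoleField (T : ℝ) : GrowthCondition T fun _ => dipoleField := by
  refine ⟨fun _ => _, fun _ => _,
    (integrable_indicator_ball_dipoleField.1.comp_snd).mono_measure Measure.restrict_le_self,
    (memLp_indicator_compl_ball_dipoleField.1.comp_snd).mono_measure Measure.restrict_le_self,
    Eventually.of_forall fun p => ?_, ?_, ?_⟩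
  · exact (congrFun (indicator_self_add_compl (Metric.ball (0 : Space 2) 1)
      fun x => (1 + ‖x‖)⁻¹ • dipoleField x) p.2).symm
  · rw [setLIntegral_const]
    exact ENNReal.mul_lt_top (memLp_one_iff_integrable.2 integrable_indicator_ball_dipoleField).2
      (by simp)
  · rw [setLIntegral_const]
    exact ENNReal.mul_lt_top memLp_indicator_compl_ball_dipoleField.2 (by simp)

/-! ### The flows through the origin -/

/-- The square of the distance to the origin along the trajectory of `x`, continued to negative
values after the trajectory has crossed the origin. -/
noncomputable def radiusSq (t : ℝ) (x : Space 2) : ℝ := ‖x‖ ^ 2 + 2 * t * (x 0 / ‖x‖)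

/-- The flow of `dipoleField` for which a trajectory reaching the origin leaves it along the image
under `A` of its incoming direction. -/
noncomputable def dipoleFlow (A : Space 2 ≃ₗᵢ[ℝ] Space 2) (t : ℝ) (x : Space 2) : Space 2 :=
  (√(radiusSq t x) / ‖x‖) • x + (√(-radiusSq t x) / ‖x‖) • A x

theorem measurable_dipoleFlow (A : Space 2 ≃ₗᵢ[ℝ] Space 2) :
    Measurable fun p : ℝ × Space 2 => dipoleFlow A p.1 p.2 := by
  have := A.continuous.measurable
  unfold dipoleFlow radiusSq
  fun_prop

theorem measurable_dipoleFlow_apply (A : Space 2 ≃ₗᵢ[ℝ] Space 2) (t : ℝ) :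
    Measurable (dipoleFlow A t) := by
  have := A.continuous.measurable
  unfold dipoleFlow radiusSq
  fun_prop

theorem continuous_dipoleFlow (A : Space 2 ≃ₗᵢ[ℝ] Space 2) (x : Space 2) :
    Continuous fun t => dipoleFlow A t x := by
  unfold dipoleFlow radiusSq
  fun_prop

theorem dipoleFlow_zero (A : Space 2 ≃ₗᵢ[ℝ] Space 2) (x : Space 2) : dipoleFlow A 0 x = x := by
  rcases eq_or_ne x 0 with rfl | hx
  · simp [dipoleFlow]
  have hx' : ‖x‖ ≠ 0 := norm_ne_zero_iff.2 hx
  have h : √(-‖x‖ ^ 2) = 0 := Real.sqrt_eq_zero_of_nonpos (by simp)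
  simp [dipoleFlow, radiusSq, h, hx']

/-- The real square root is `0` on negative numbers, so only one term of the flow is active at a
time; both vanish at the crossing, which makes trajectories continuous there. -/
theorem dipoleFlow_of_pos (A : Space 2 ≃ₗᵢ[ℝ] Space 2) {t : ℝ} {x : Space 2}
    (h : 0 ≤ radiusSq t x) : dipoleFlow A t x = (√(radiusSq t x) / ‖x‖) • x := by
  simp [dipoleFlow, Real.sqrt_eq_zero_of_nonpos (neg_nonpos.2 h)]

theorem dipoleFlow_of_neg (A : Space 2 ≃ₗᵢ[ℝ] Space 2) {t : ℝ} {x : Space 2}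
    (h : radiusSq t x ≤ 0) : dipoleFlow A t x = (√(-radiusSq t x) / ‖x‖) • A x := by
  simp [dipoleFlow, Real.sqrt_eq_zero_of_nonpos h]

theorem abs_coord_div_norm_le (x : Space 2) : |x 0 / ‖x‖| ≤ 1 := by
  rw [abs_div, abs_norm]
  exact div_le_one_of_le₀ (PiLp.norm_apply_le x 0) (norm_nonneg _)

theorem abs_radiusSq_le (t : ℝ) (x : Space 2) : |radiusSq t x| ≤ (‖x‖ + |t| + 1) ^ 2 := by
  have h1 : |2 * t * (x 0 / ‖x‖)| ≤ 2 * |t| := by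
    rw [abs_mul, abs_mul, abs_two]
    exact mul_le_of_le_one_right (by positivity) (abs_coord_div_norm_le x)
  have h2 : |radiusSq t x| ≤ ‖x‖ ^ 2 + 2 * |t| :=
    (abs_add_le _ _).trans (by rw [abs_of_nonneg (sq_nonneg ‖x‖)]; gcongr)
  nlinarith [norm_nonneg x, abs_nonneg t, mul_nonneg (norm_nonneg x) (abs_nonneg t)]

theorem norm_dipoleFlow_le (A : Space 2 ≃ₗᵢ[ℝ] Space 2) (t : ℝ) (x : Space 2) :
    ‖dipoleFlow A t x‖ ≤ ‖x‖ + |t| + 1 := by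
  have hb : ∀ s : ℝ, s ≤ |radiusSq t x| → √s / ‖x‖ * ‖x‖ ≤ ‖x‖ + |t| + 1 := fun s hs => by
    rcases eq_or_ne x 0 with rfl | hx
    · rw [norm_zero, mul_zero]; positivity
    rw [div_mul_cancel₀ _ (norm_ne_zero_iff.2 hx)]
    exact Real.sqrt_le_iff.2 ⟨by positivity, hs.trans (abs_radiusSq_le t x)⟩
  rcases le_total 0 (radiusSq t x) with h | h
  · rw [dipoleFlow_of_pos A h, norm_smul, Real.norm_of_nonneg (by positivity)]
    exact hb _ (le_abs_self _)
  · rw [dipoleFlow_of_neg A h, norm_smul, Real.norm_of_nonneg (by positivity), A.norm_map]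
    exact hb _ (neg_le_abs _)

theorem dipoleField_smul {a : ℝ} (ha : 0 < a) (x : Space 2) :
    dipoleField (a • x) = a⁻¹ • dipoleField x := by
  simp only [dipoleField, norm_smul, PiLp.smul_apply, smul_eq_mul, Real.norm_of_nonneg ha.le,
    smul_smul]
  congr 1
  rcases eq_or_ne x 0 with rfl | hx
  · simp
  have hx' : ‖x‖ ≠ 0 := norm_ne_zero_iff.2 hx
  field_simp

theorem dipoleField_map {A : Space 2 ≃ₗᵢ[ℝ] Space 2} (hA : ∀ x, A x 0 = -x 0) (x : Space 2) :
    dipoleField (A x) = -(x 0 / ‖x‖ ^ 3) • A x := by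
  simp only [dipoleField, hA, A.norm_map, neg_div]

theorem hasDerivAt_radiusSq (t : ℝ) (x : Space 2) :
    HasDerivAt (fun t => radiusSq t x) (2 * (x 0 / ‖x‖)) t := by
  have := (((hasDerivAt_id t).const_mul 2).mul_const (x 0 / ‖x‖)).const_add (‖x‖ ^ 2)
  simpa [radiusSq] using this

/-- Before the crossing this is `(r²)' = 2 cos θ`. After it the squared radius is `-radiusSq`, with
the opposite derivative, and `hA` reverses the cosine of the direction accordingly. -/
theorem hasDerivAt_dipoleFlow {A : Space 2 ≃ₗᵢ[ℝ] Space 2} (hA : ∀ x, A x 0 = -x 0) {t : ℝ}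
    {x : Space 2} (hx : x ≠ 0) (h : radiusSq t x ≠ 0) :
    HasDerivAt (fun t => dipoleFlow A t x) (dipoleField (dipoleFlow A t x)) t := by
  have hx' : 0 < ‖x‖ := norm_pos_iff.2 hx
  have hr := hasDerivAt_radiusSq t x
  rcases h.lt_or_gt with h | h
  · have hs : 0 < √(-radiusSq t x) := Real.sqrt_pos.2 (neg_pos.2 h)
    have hd := ((hr.fun_neg.sqrt (neg_ne_zero.2 h.ne)).div_const ‖x‖).smul_const (A x)
    have he : ∀ᶠ s in 𝓝 t, dipoleFlow A s x = (√(-radiusSq s x) / ‖x‖) • A x := by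
      filter_upwards [hr.continuousAt.eventually_lt_const h] with s hs
      exact dipoleFlow_of_neg A hs.le
    refine (hd.congr_of_eventuallyEq he).congr_deriv ?_
    rw [dipoleFlow_of_neg A h.le, dipoleField_smul (by positivity), dipoleField_map hA, smul_smul]
    congr 1
    field_simp
  · have hs : 0 < √(radiusSq t x) := Real.sqrt_pos.2 h
    have hd := ((hr.sqrt h.ne').div_const ‖x‖).smul_const x
    have he : ∀ᶠ s in 𝓝 t, dipoleFlow A s x = (√(radiusSq s x) / ‖x‖) • x := by
      filter_upwards [hr.continuousAt.eventually_const_lt h] with s hs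
      exact dipoleFlow_of_pos A hs.le
    refine (hd.congr_of_eventuallyEq he).congr_deriv ?_
    rw [dipoleFlow_of_pos A h.le, dipoleField_smul (by positivity), dipoleField, smul_smul]
    congr 1
    field_simp

/-- `radiusSq` is affine in `t`, and if its slope is zero it equals `|x|² > 0`; hence there is at
most one crossing time. -/
theorem countable_radiusSq_eq_zero {x : Space 2} (hx : x ≠ 0) :
    {t | radiusSq t x = 0}.Countable := by
  refine Set.Subsingleton.countable fun s hs t ht => ?_
  simp only [radiusSq, mem_ofPred_eq] at hs ht
  have hx' : 0 < ‖x‖ := norm_pos_iff.2 hx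
  have h : x 0 / ‖x‖ ≠ 0 := fun h0 => by
    rw [h0] at hs; nlinarith
  exact mul_right_cancel₀ h (by linarith)

/-! ### Bounded compression -/

/-- Integration in polar coordinates. -/
theorem lintegral_eq_lintegral_toSphere {f : Space 2 → ℝ≥0∞} (hf : Measurable f) :
    ∫⁻ x, f x = ∫⁻ e : Metric.sphere (0 : Space 2) 1,
      (∫⁻ r in Ioi (0 : ℝ), ENNReal.ofReal r * f (r • (e : Space 2)))
        ∂(volume : Measure (Space 2)).toSphere := by
  have hmp := (Measure.measurePreserving_homeomorphUnitSphereProd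
    (volume : Measure (Space 2))).symm (homeomorphUnitSphereProd (Space 2)).toMeasurableEquiv
  have h0 : ∫⁻ x, f x = ∫⁻ x : ({0}ᶜ : Set (Space 2)), f x ∂(volume.comap Subtype.val) := by
    rw [lintegral_subtype_comap (measurableSet_singleton _).compl, restrict_compl_singleton]
  have h1 := hmp.lintegral_comp (hf.comp measurable_subtype_coe)
  simp only [Function.comp_apply] at h1
  rw [h0, ← h1, lintegral_prod]
  · refine lintegral_congr fun e => ?_
    rw [Measure.volumeIoiPow, lintegral_withDensity_eq_lintegral_mul]
    · rw [← lintegral_subtype_comap measurableSet_Ioi]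
      simp [homeomorphUnitSphereProd_symm_apply_coe]
    · fun_prop
    · exact hf.comp (measurable_subtype_coe.comp (hmp.measurable.comp measurable_prodMk_left))
  · exact (hf.comp (measurable_subtype_coe.comp hmp.measurable)).aemeasurable

theorem measurableSet_pos_and_mul_pos (s c : ℝ) :
    MeasurableSet {r : ℝ | 0 < r ∧ 0 < s * (r ^ 2 + c)} := by
  have h : {r : ℝ | 0 < r ∧ 0 < s * (r ^ 2 + c)} =
      Ioi 0 ∩ (fun r : ℝ => s * (r ^ 2 + c)) ⁻¹' Ioi 0 := by
    ext r; simp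
  rw [h]
  exact measurableSet_Ioi.inter (measurableSet_Ioi.preimage (by fun_prop))

/-- The change of variables `u² = ±(r² + c)` preserves the measure `r dr`. -/
theorem setLIntegral_sqrt_le {s : ℝ} (hs : |s| = 1) (c : ℝ) (g : ℝ → ℝ≥0∞) :
    ∫⁻ r in {r | 0 < r ∧ 0 < s * (r ^ 2 + c)}, ENNReal.ofReal r * g (√(s * (r ^ 2 + c))) ≤
      ∫⁻ u in Ioi (0 : ℝ), ENNReal.ofReal u * g u := by
  set S : Set ℝ := {r | 0 < r ∧ 0 < s * (r ^ 2 + c)} with hS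
  set f : ℝ → ℝ := fun r => √(s * (r ^ 2 + c)) with hf
  have hs0 : s ≠ 0 := fun h => by simp [h] at hs
  have hSm : MeasurableSet S := measurableSet_pos_and_mul_pos s c
  have hd : ∀ r ∈ S, HasDerivWithinAt f (s * (2 * r) / (2 * f r)) S r := fun r hr => by
    have h := ((((hasDerivAt_id r).pow 2).add_const c).const_mul s).sqrt hr.2.ne'
    refine HasDerivAt.hasDerivWithinAt ?_
    simpa [hf] using h
  have hinj : InjOn f S := fun a ha b hb hab => by
    have h1 := (Real.sqrt_inj ha.2.le hb.2.le).1 hab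
    have h2 : a ^ 2 = b ^ 2 := by linarith [mul_left_cancel₀ hs0 h1]
    exact (sq_eq_sq₀ ha.1.le hb.1.le).1 h2
  have hmap : f '' S ⊆ Ioi 0 := by
    rintro _ ⟨r, hr, rfl⟩
    exact Real.sqrt_pos.2 hr.2
  -- The change of variables is exact on the image; the inequality only comes from enlarging the
  -- image to the half-line.
  refine le_trans (le_of_eq ?_) (lintegral_mono_set hmap)
  rw [lintegral_image_eq_lintegral_abs_deriv_mul hSm hd hinj]
  refine setLIntegral_congr_fun hSm fun r hr => ?_
  have hfr : 0 < f r := Real.sqrt_pos.2 hr.2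
  change _ = ENNReal.ofReal |s * (2 * r) / (2 * f r)| * (ENNReal.ofReal (f r) * g (f r))
  rw [← mul_assoc, ← ENNReal.ofReal_mul (abs_nonneg _), abs_div, abs_mul, hs, one_mul,
    abs_of_pos (by linarith [hr.1] : 0 < 2 * r), abs_of_pos (by linarith : 0 < 2 * f r)]
  congr 2
  field_simp

/-- On each ray the points that have not crossed contribute at most the integral of `F`, and those
that have crossed at most that of `F ∘ A`. As `A` preserves the measure, the two branches give the
factor `2`. -/
theorem lintegral_comp_dipoleFlow_le (A : Space 2 ≃ₗᵢ[ℝ] Space 2) (t : ℝ) {F : Space 2 → ℝ≥0∞}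
    (hF : Measurable F) : ∫⁻ x, F (dipoleFlow A t x) ≤ 2 * ∫⁻ x, F x := by
  have hX := measurable_dipoleFlow_apply A t
  have hFA : Measurable fun x => F (A x) := hF.comp A.continuous.measurable
  have hA : ∫⁻ x, F (A x) = ∫⁻ x, F x := A.measurePreserving.lintegral_comp hF
  have h2 : 2 * ∫⁻ x, F x = ∫⁻ x, (F x + F (A x)) := by
    rw [lintegral_add_left hF, hA, two_mul]
  rw [h2, lintegral_eq_lintegral_toSphere (f := fun x => F (dipoleFlow A t x)) (hF.comp hX),
    lintegral_eq_lintegral_toSphere (f := fun x => F x + F (A x)) (hF.add hFA)]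
  refine lintegral_mono fun e => ?_
  have he : ‖(e : Space 2)‖ = 1 := by simp
  set c : ℝ := 2 * t * (e : Space 2) 0 with hc
  have hrad : ∀ r : ℝ, 0 < r → radiusSq t (r • (e : Space 2)) = r ^ 2 + c := fun r hr => by
    simp only [radiusSq, norm_smul, he, mul_one, Real.norm_of_nonneg hr.le, PiLp.smul_apply,
      smul_eq_mul, hc]
    field_simp
  -- On a ray, the only radius sitting at the origin at time `t` is `√(-c)`, a null set.
  have hsub : Ioi (0 : ℝ) ⊆ ({r | 0 < r ∧ 0 < 1 * (r ^ 2 + c)} ∪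
      {r | 0 < r ∧ 0 < -1 * (r ^ 2 + c)}) ∪ {√(-c)} := fun r hr => by
    rcases lt_trichotomy (r ^ 2 + c) 0 with h | h | h
    · exact Or.inl (Or.inr ⟨hr, by linarith⟩)
    · refine Or.inr ?_
      rw [mem_singleton_iff, ← Real.sqrt_sq (le_of_lt hr)]
      congr 1; linarith
    · exact Or.inl (Or.inl ⟨hr, by linarith⟩)
  have hm : ∀ s : ℝ, MeasurableSet {r : ℝ | 0 < r ∧ 0 < s * (r ^ 2 + c)} :=
    fun s => measurableSet_pos_and_mul_pos s c
  simp only [mul_add]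
  rw [lintegral_add_left (by fun_prop)]
  refine (lintegral_mono_set hsub).trans ((lintegral_union_le _ _ _).trans ?_)
  rw [Measure.restrict_singleton, Real.volume_singleton, zero_smul, lintegral_zero_measure,
    add_zero]
  refine (lintegral_union_le _ _ _).trans (add_le_add ?_ ?_)
  · refine le_trans (le_of_eq (setLIntegral_congr_fun (hm 1) fun r hr => ?_))
      (setLIntegral_sqrt_le (s := 1) (by simp) c fun u => F (u • (e : Space 2)))
    have hr0 : 0 < r := hr.1
    have h := hr.2
    rw [one_mul, ← hrad r hr0] at h
    simp only [dipoleFlow_of_pos A h.le, hrad r hr0, norm_smul, he, Real.norm_of_nonneg hr0.le,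
      smul_smul, mul_one, one_mul, div_mul_cancel₀ _ hr0.ne']
  · refine le_trans (le_of_eq (setLIntegral_congr_fun (hm (-1)) fun r hr => ?_))
      (setLIntegral_sqrt_le (s := -1) (by simp) c fun u => F (A (u • (e : Space 2))))
    have hr0 : 0 < r := hr.1
    have h := hr.2
    rw [neg_one_mul, ← hrad r hr0] at h
    simp only [dipoleFlow_of_neg A (neg_pos.1 h).le, hrad r hr0, norm_smul, he, map_smul,
      Real.norm_of_nonneg hr0.le, smul_smul, mul_one, neg_one_mul, div_mul_cancel₀ _ hr0.ne']

theorem map_dipoleFlow_le (A : Space 2 ≃ₗᵢ[ℝ] Space 2) (t : ℝ) :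
    Measure.map (dipoleFlow A t) volume ≤ (2 : ℝ≥0) • (volume : Measure (Space 2)) := by
  have hX := measurable_dipoleFlow_apply A t
  refine Measure.le_iff.2 fun s hs => ?_
  have h := lintegral_comp_dipoleFlow_le A t (F := s.indicator 1) (measurable_one.indicator hs)
  rw [lintegral_indicator_one hs] at h
  have h1 : (fun x => s.indicator (1 : Space 2 → ℝ≥0∞) (dipoleFlow A t x)) =
      (dipoleFlow A t ⁻¹' s).indicator 1 := rfl
  rw [h1, lintegral_indicator_one (hX hs)] at h
  rw [Measure.map_apply hX hs]
  simpa using h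

/-! ### The flow equation -/

theorem integrable_indicator_dipoleField (ρ : ℝ) :
    Integrable ((Metric.ball (0 : Space 2) ρ).indicator dipoleField) :=
  integrable_of_norm_le_div_norm (C := 1) (r := ρ)
    (measurable_dipoleField.indicator measurableSet_ball).aestronglyMeasurable
    (fun x => (norm_indicator_le_norm_self _ _).trans (norm_dipoleField_le x))
    (fun x hx => by simp [hx])

theorem integrable_indicator_dipoleField_dipoleFlow (A : Space 2 ≃ₗᵢ[ℝ] Space 2) (T ρ : ℝ) :
    Integrable (fun p : ℝ × Space 2 =>
      (Metric.ball (0 : Space 2) ρ).indicator (fun x => dipoleField (dipoleFlow A p.1 x)) p.2)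
      ((volume.restrict (Ioo 0 T)).prod volume) := by
  have hm : Measurable fun p : ℝ × Space 2 =>
      (Metric.ball (0 : Space 2) ρ).indicator (fun x => dipoleField (dipoleFlow A p.1 x)) p.2 :=
    (measurable_dipoleField.comp (measurable_dipoleFlow A)).indicator
      (measurableSet_ball.preimage measurable_snd)
  refine ⟨hm.aestronglyMeasurable, ?_⟩
  rw [hasFiniteIntegral_iff_enorm, lintegral_prod _ hm.enorm.aemeasurable]
  -- Up to time `T` the flow maps the ball of radius `ρ` into that of radius `ρ + T + 1`;
  -- compression by the factor `2` then bounds the integral uniformly in time.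
  set K := 2 * ∫⁻ y, ‖(Metric.ball (0 : Space 2) (ρ + T + 1)).indicator dipoleField y‖ₑ with hK
  have hb : ∀ t ∈ Ioo 0 T, ∫⁻ x, ‖(Metric.ball (0 : Space 2) ρ).indicator
      (fun x => dipoleField (dipoleFlow A t x)) x‖ₑ ≤ K := fun t ht => by
    refine le_trans (lintegral_mono fun x => ?_) (lintegral_comp_dipoleFlow_le A t
      (measurable_dipoleField.indicator measurableSet_ball).enorm)
    by_cases hx : x ∈ Metric.ball (0 : Space 2) ρ
    · have hx' : dipoleFlow A t x ∈ Metric.ball (0 : Space 2) (ρ + T + 1) := by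
        have h := norm_dipoleFlow_le A t x
        rw [abs_of_pos ht.1] at h
        simp only [Metric.mem_ball, dist_zero_right] at hx ⊢
        linarith [ht.2]
      rw [indicator_of_mem hx, indicator_of_mem hx']
    · rw [indicator_of_notMem hx]; simp
  refine (setLIntegral_mono measurable_const hb).trans_lt ?_
  rw [setLIntegral_const]
  exact ENNReal.mul_lt_top (ENNReal.mul_lt_top (by simp)
    (integrable_indicator_dipoleField _).2) (by simp)

theorem dipoleFlow_equation {A : Space 2 ≃ₗᵢ[ℝ] Space 2} (hA : ∀ x, A x 0 = -x 0) {T : ℝ}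
    (hT : 0 < T) {h : Space 2 → ℝ} (hh : IsLogRenormalizer h) {ψ : ℝ × Space 2 → ℝ}
    (hψ : IsTestFunction (Ioo 0 T ×ˢ univ) ψ) :
    - ∫ p in Ioo 0 T ×ˢ (univ : Set (Space 2)), h (dipoleFlow A p.1 p.2) * fderiv ℝ ψ p (1, 0) =
      ∫ p in Ioo 0 T ×ˢ (univ : Set (Space 2)),
        fderiv ℝ h (dipoleFlow A p.1 p.2) (dipoleField (dipoleFlow A p.1 p.2)) * ψ p := by
  have hν : (volume : Measure (ℝ × Space 2)).restrict (Ioo 0 T ×ˢ univ) =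
      (volume.restrict (Ioo 0 T)).prod volume := by
    rw [Measure.volume_eq_prod, ← Measure.prod_restrict, Measure.restrict_univ]
  rw [hν]
  set ν : Measure (ℝ × Space 2) := (volume.restrict (Ioo 0 T)).prod volume with hνdef
  have hX := measurable_dipoleFlow A
  have hψ1 : Continuous (fderiv ℝ ψ) := hψ.smooth.continuous_fderiv (by simp)
  obtain ⟨ρ, hρ⟩ := hψ.compact.isCompact.isBounded.subset_ball 0
  have hsupp : ∀ p : ℝ × Space 2, p.2 ∉ Metric.ball (0 : Space 2) ρ → p ∉ tsupport ψ :=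
    fun p hp hp' => hp (by
      have h1 := hρ hp'
      simp only [Metric.mem_ball, dist_zero_right] at h1 ⊢
      exact (norm_snd_le p).trans_lt h1)
  obtain ⟨M, hM⟩ := hψ.smooth.continuous.bounded_above_of_compact_support hψ.compact
  obtain ⟨M₁, hM₁⟩ := (hψ1.clm_apply continuous_const : Continuous fun p =>
    fderiv ℝ ψ p ((1 : ℝ), (0 : Space 2))).bounded_above_of_compact_support
      ((hψ.compact.fderiv (𝕜 := ℝ)).comp_left
        (g := fun L : ℝ × Space 2 →L[ℝ] ℝ => L ((1 : ℝ), (0 : Space 2))) (by simp))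
  obtain ⟨Mh, hMh⟩ := (isCompact_closedBall (0 : Space 2) (ρ + T + 1)).exists_bound_of_continuousOn
    hh.contDiff.continuous.continuousOn
  obtain ⟨C, hC⟩ := hh.bound
  have hC' : ∀ z, ‖fderiv ℝ h z‖ ≤ |C| := fun z => (hC z).2.trans
    ((div_le_div_of_nonneg_right (le_abs_self C) (by positivity)).trans
      (div_le_self (abs_nonneg C) (by linarith [norm_nonneg z])))
  have hI₁ : Integrable (fun p : ℝ × Space 2 =>
      h (dipoleFlow A p.1 p.2) * fderiv ℝ ψ p (1, 0)) ν := by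
    have hbound : Integrable (fun p : ℝ × Space 2 =>
        (Metric.ball (0 : Space 2) ρ).indicator (fun _ => Mh * M₁) p.2) ν :=
      ((integrable_indicator_iff measurableSet_ball).2
        (integrableOn_const (by exact measure_ball_lt_top.ne))).comp_snd _
    refine hbound.mono' (Measurable.aestronglyMeasurable ?_) ?_
    · exact (hh.contDiff.continuous.measurable.comp hX).mul
        (hψ1.clm_apply continuous_const).measurable
    · have hae : ∀ᵐ p ∂ν, p.1 ∈ Ioo 0 T :=
        Measure.quasiMeasurePreserving_fst.ae (ae_restrict_mem measurableSet_Ioo)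
      filter_upwards [hae] with p hp
      by_cases hx : p.2 ∈ Metric.ball (0 : Space 2) ρ
      · rw [indicator_of_mem hx, norm_mul]
        have hmem : dipoleFlow A p.1 p.2 ∈ Metric.closedBall (0 : Space 2) (ρ + T + 1) := by
          have h1 := norm_dipoleFlow_le A p.1 p.2
          rw [abs_of_pos hp.1] at h1
          simp only [Metric.mem_ball, Metric.mem_closedBall, dist_zero_right] at hx ⊢
          linarith [hp.2]
        exact mul_le_mul (hMh _ hmem) (hM₁ p) (norm_nonneg _)
          ((norm_nonneg _).trans (hMh _ hmem))
      · have h0 : fderiv ℝ ψ p = 0 := image_eq_zero_of_notMem_tsupport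
          fun h1 => hsupp p hx (tsupport_fderiv_subset ℝ h1)
        rw [indicator_of_notMem hx, h0]; simp
  have hI₂ : Integrable (fun p : ℝ × Space 2 =>
      fderiv ℝ h (dipoleFlow A p.1 p.2) (dipoleField (dipoleFlow A p.1 p.2)) * ψ p) ν := by
    refine ((integrable_indicator_dipoleField_dipoleFlow A T ρ).norm.const_mul (|C| * M)).mono'
      (Measurable.aestronglyMeasurable ?_) (Eventually.of_forall fun p => ?_)
    · have hmB : Measurable fun z : Space 2 => fderiv ℝ h z (dipoleField z) := by
        have hc : Continuous (fderiv ℝ h) := hh.contDiff.continuous_fderiv (by simp)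
        exact (isBoundedBilinearMap_apply.continuous).measurable.comp
          (hc.measurable.prodMk measurable_dipoleField)
      exact (hmB.comp hX).mul hψ.smooth.continuous.measurable
    · by_cases hx : p.2 ∈ Metric.ball (0 : Space 2) ρ
      · rw [indicator_of_mem hx, norm_mul]
        calc _ ≤ (|C| * ‖dipoleField (dipoleFlow A p.1 p.2)‖) * M :=
              mul_le_mul (((fderiv ℝ h _).le_opNorm _).trans (by gcongr; exact hC' _)) (hM p)
                (norm_nonneg _) (by positivity)
          _ = _ := by ring
      · have h0 : ψ p = 0 := image_eq_zero_of_notMem_tsupport (hsupp p hx)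
        rw [indicator_of_notMem hx, h0]; simp
  -- The integrand is the time derivative of `h(X) ψ`, and Fubini reduces the claim to a single
  -- trajectory.
  have hzero : ∫ p, (h (dipoleFlow A p.1 p.2) * fderiv ℝ ψ p (1, 0) +
      fderiv ℝ h (dipoleFlow A p.1 p.2) (dipoleField (dipoleFlow A p.1 p.2)) * ψ p) ∂ν = 0 := by
    have hI := hI₁.fun_add hI₂
    rw [hνdef, integral_prod_symm _ hI]
    refine integral_eq_zero_of_ae ?_
    have hne : ∀ᵐ x : Space 2, x ≠ 0 := by simp [ae_iff]
    filter_upwards [hI.prod_left_ae, hne] with x hx hx0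
    have hend : ∀ t, t ∉ Ioo 0 T → ψ (t, x) = 0 := fun t ht =>
      image_eq_zero_of_notMem_tsupport fun h1 => ht (hψ.support_subset h1).1
    -- Continuity through the crossing, differentiability at all other times and integrability of
    -- the derivative suffice for the fundamental theorem of calculus; the boundary terms vanish
    -- because `ψ` does at times `0` and `T`.
    have hftc := integral_eq_of_hasDerivAt_off_countable_of_le
      (fun t => h (dipoleFlow A t x) * ψ (t, x))
      (fun t => h (dipoleFlow A t x) * fderiv ℝ ψ (t, x) (1, 0) +
        fderiv ℝ h (dipoleFlow A t x) (dipoleField (dipoleFlow A t x)) * ψ (t, x))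
      hT.le (countable_radiusSq_eq_zero hx0)
      (((hh.contDiff.continuous.comp (continuous_dipoleFlow A x)).mul
        (hψ.smooth.continuous.comp (by fun_prop))).continuousOn)
      (fun t ht => ?_)
      ((intervalIntegrable_iff_integrableOn_Ioo_of_le hT.le).2 hx)
    · rw [hend T (by simp), hend 0 (by simp), intervalIntegral.integral_of_le hT.le,
        integral_Ioc_eq_integral_Ioo, mul_zero, mul_zero, sub_zero] at hftc
      exact hftc
    · have hdh := (hh.contDiff.differentiable (by simp) (dipoleFlow A t x)).hasFDerivAt
      have h1 := hdh.comp_hasDerivAt t (hasDerivAt_dipoleFlow hA hx0 ht.2)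
      have h2 : HasDerivAt (fun t : ℝ => ψ (t, x)) (fderiv ℝ ψ (t, x) (1, 0)) t :=
        ((hψ.smooth.differentiable (by simp)) (t, x)).hasFDerivAt.comp_hasDerivAt t
          ((hasDerivAt_id t).prodMk (hasDerivAt_const t x))
      exact (h1.fun_mul h2).congr_deriv (add_comm _ _)
  rw [integral_add hI₁ hI₂] at hzero
  linarith

/-- Every trajectory is continuous in time, and on a ball, which has finite measure, pointwise
convergence along sequences implies convergence in measure. -/
theorem tendstoInMeasure_dipoleFlow (A : Space 2 ≃ₗᵢ[ℝ] Space 2) (s : Set ℝ) (t r : ℝ) :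
    TendstoInMeasure (volume.restrict (Metric.ball (0 : Space 2) r)) (dipoleFlow A) (𝓝[s] t)
      (dipoleFlow A t) := by
  have : IsFiniteMeasure ((volume : Measure (Space 2)).restrict (Metric.ball 0 r)) :=
    ⟨by rw [Measure.restrict_apply_univ]; exact measure_ball_lt_top⟩
  intro ε hε
  refine tendsto_of_seq_tendsto fun u hu => ?_
  exact tendstoInMeasure_of_tendsto_ae (f := fun n => dipoleFlow A (u n))
    (fun n => (measurable_dipoleFlow_apply A (u n)).aestronglyMeasurable)
    (Eventually.of_forall fun x => ((continuous_dipoleFlow A x).tendsto t).comp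
      (hu.mono_right nhdsWithin_le_nhds)) ε hε

theorem isRegularLagrangianFlow_dipoleFlow {A : Space 2 ≃ₗᵢ[ℝ] Space 2}
    (hA : ∀ x, A x 0 = -x 0) {T : ℝ} (hT : 0 < T) :
    IsRegularLagrangianFlow (fun _ => dipoleField) 0 T (dipoleFlow A) where
  growth := growthCondition_dipoleField T
  measurable_slice t _ := (measurable_dipoleFlow_apply A t).aemeasurable
  measurable_joint := (measurable_dipoleFlow A).aemeasurable
  continuous t _ r _ := tendstoInMeasure_dipoleFlow A _ t r
  log_bounded r hr := by
    have hfin : ENNReal.ofReal (Real.log (1 + (r + T + 1))) *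
        volume (Metric.ball (0 : Space 2) r) ≠ ⊤ :=
      ENNReal.mul_ne_top ENNReal.ofReal_ne_top measure_ball_lt_top.ne
    refine ⟨(ENNReal.ofReal (Real.log (1 + (r + T + 1))) *
      volume (Metric.ball (0 : Space 2) r)).toNNReal, fun t ht => ?_⟩
    rw [ENNReal.coe_toNNReal hfin, ← setLIntegral_const]
    refine setLIntegral_mono measurable_const fun x hx => ?_
    have h := norm_dipoleFlow_le A t x
    rw [abs_of_nonneg ht.1] at h
    simp only [Metric.mem_ball, dist_zero_right] at hx
    gcongr
    linarith [ht.2]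
  equation h hh ψ hψ := dipoleFlow_equation hA hT hh hψ
  initial := Eventually.of_forall (dipoleFlow_zero A)
  compression := ⟨2, fun t _ => map_dipoleFlow_le A t⟩

/-! ### Non-uniqueness -/

/-- The reflection of the plane in the second coordinate axis. -/
noncomputable def planeReflection : Space 2 ≃ₗᵢ[ℝ] Space 2 :=
  LinearIsometryEquiv.piLpCongrRight 2 fun i : Fin 2 =>
    if i = 0 then LinearIsometryEquiv.neg ℝ else LinearIsometryEquiv.refl ℝ ℝ

theorem planeReflection_apply_zero (x : Space 2) : planeReflection x 0 = -x 0 := by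
  simp [planeReflection]

theorem planeReflection_apply_one (x : Space 2) : planeReflection x 1 = x 1 := by
  simp [planeReflection]

/-- The points off the first axis that have crossed the origin by time `T` leave with second
coordinates of opposite signs in the two flows; those in the upper half-plane form a nonempty open
set, hence one of positive measure. -/
theorem not_dipoleFlow_ae_eq {T : ℝ} (hT : 0 < T) :
    ¬ (dipoleFlow (LinearIsometryEquiv.neg ℝ) T =ᵐ[volume] dipoleFlow planeReflection T) := by
  intro hae
  have hop : IsOpen {x : Space 2 | ‖x‖ ^ 3 + 2 * T * x 0 < 0 ∧ 0 < x 1} :=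
    (isOpen_lt (by fun_prop) continuous_const).and (isOpen_lt continuous_const (by fun_prop))
  have hne : {x : Space 2 | ‖x‖ ^ 3 + 2 * T * x 0 < 0 ∧ 0 < x 1}.Nonempty := by
    -- The point `(-δ, δ)` has norm at most `2δ`, and `δ² ≤ T / 16` makes `(2δ)³ ≤ Tδ / 2 < 2Tδ`.
    set δ : ℝ := min 1 T / 4 with hδ
    have hm : 0 < min 1 T := lt_min one_pos hT
    have hδ0 : 0 < δ := by positivity
    have hδ1 : δ ≤ 1 / 4 := by linarith [min_le_left 1 T]
    have hδT : δ ≤ T / 4 := by linarith [min_le_right 1 T]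
    refine ⟨!₂[-δ, δ], ?_, by simpa using hδ0⟩
    have hn : ‖(!₂[-δ, δ] : Space 2)‖ ≤ 2 * δ := by
      rw [EuclideanSpace.norm_eq, Fin.sum_univ_two]
      refine Real.sqrt_le_iff.2 ⟨by positivity, ?_⟩
      simp
      nlinarith
    have h3 : ‖(!₂[-δ, δ] : Space 2)‖ ^ 3 ≤ (2 * δ) ^ 3 := by gcongr
    have h4 : (2 * δ) ^ 3 < 2 * T * δ := by
      have : δ * (δ * δ) ≤ δ * (1 / 4 * (T / 4)) := by gcongr
      nlinarith [mul_pos hδ0 hT]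
    simp
    linarith
  refine (hop.measure_pos volume hne).ne' (measure_mono_null (fun x hx => ?_) hae)
  obtain ⟨h1, h2⟩ := hx
  have hx0 : x ≠ 0 := fun h0 => by simp [h0] at h2
  have hx' : 0 < ‖x‖ := norm_pos_iff.2 hx0
  have hr : radiusSq T x < 0 := by
    have : radiusSq T x = (‖x‖ ^ 3 + 2 * T * x 0) / ‖x‖ := by
      rw [radiusSq]; field_simp
    rw [this]
    exact div_neg_of_neg_of_pos h1 hx'
  have hk : 0 < √(-radiusSq T x) / ‖x‖ := div_pos (Real.sqrt_pos.2 (neg_pos.2 hr)) hx'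
  intro heq
  have h3 := congrArg (fun z : Space 2 => z 1) heq
  simp only [dipoleFlow_of_neg _ hr.le, PiLp.smul_apply, smul_eq_mul,
    planeReflection_apply_one, LinearIsometryEquiv.coe_neg, PiLp.neg_apply] at h3
  nlinarith [mul_pos hk h2]

theorem proposition1 :
    ∃ (B : Space 2 → Space 2) (m : ℕ) (Ω : Fin 2 → Fin m → Space 2 → ℝ),
      Measurable B ∧
      MemL1AddLinfty (fun x => ‖B x‖ / (‖x‖ + 1)) ∧
      IsDivergenceFree B ∧
      (∀ i j, IsRoughProfile (Ω i j)) ∧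
      (∀ R : ℝ, 1 < R → ∃ μ : Fin 2 → Fin m → SignedMeasure (Space 2),
        ∀ i l : Fin 2,
          PartialDerivEqSingularConv (Metric.ball 0 R) l (fun x => B x i) (Ω i) (μ l)) ∧
      (∀ T : ℝ, 0 < T → ∃ X₁ X₂ : ℝ → Space 2 → Space 2,
        IsRegularLagrangianFlow (fun _ => B) 0 T X₁ ∧
        IsRegularLagrangianFlow (fun _ => B) 0 T X₂ ∧
        ∃ t ∈ Icc 0 T, ¬ (X₁ t =ᵐ[volume] X₂ t)) :=
  ⟨dipoleField, 2, dipoleProfile, measurable_dipoleField, memL1AddLinfty_dipoleField,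
    isDivergenceFree_dipoleField, isRoughProfile_dipoleProfile,
    fun R _ => ⟨fun l j => if l = j then VectorMeasure.dirac 0 1 else 0,
      fun i l => partialDerivEqSingularConv_dipoleField _ i l⟩,
    fun T hT => ⟨_, _,
      isRegularLagrangianFlow_dipoleFlow (A := LinearIsometryEquiv.neg ℝ) (fun x => by simp) hT,
      isRegularLagrangianFlow_dipoleFlow planeReflection_apply_zero hT,
      T, right_mem_Icc.2 hT.le, not_dipoleFlow_ae_eq hT⟩⟩
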